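/- Fix an integer $q\ge 2$ and a real number $p$ with $0<p<\frac{q-1}{q}$. For a positive integer $n$ put $d=\lfloor pn\rfloor$. A $q$-ary code of length $n$ is a subset $C$ of $[q]^n$, where $[q]$ is an alphabet of $q$ letters; it has minimum distance at least $m$ if any two distinct words of $C$ differ in at least $m$ coordinates. Let $A_q(n,m)$ be the largest size of such a code, and let \[ \mathrm{vol}_q(n,d)=\sum_{i=0}^{d}\binom{n}{i}(q-1)^i \] be the number of words in a Hamming ball of radius $d$ in $[q]^n$. Then there is a constant $c=c_{p,q}>0$ such that for every positive integer $n$ the number of $q$-ary codes of length $n$ with minimum distance at least $d+1$ is at least \[ \exp\left(c\,n^2\cdot\frac{q^n}{\mathrm{vol}_q(n,d)}\right). \] Moreover, there is a constant $c'=c'_{p,q}>0$ such that for every positive integer $n$ \[ A_q(n,d+1)\ \ge\ c'\,n\cdot\frac{q^n}{\mathrm{vol}_q(n,d)} . \] -/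

import Mathlib

namespace QaryCode

/-- A `q`-ary word of length `n`. -/
abbrev Word (q n : ℕ) : Type := Fin n → Fin q

/-- The code `C` (a set of words) has minimum distance at least `d`: any two distinct codewords
are at Hamming distance at least `d`. In particular this holds for codes with at most one word. -/
def HasMinDist {q n : ℕ} (d : ℕ) (C : Finset (Word q n)) : Prop :=
  ∀ x ∈ C, ∀ y ∈ C, x ≠ y → d ≤ hammingDist x y

instance {q n : ℕ} (d : ℕ) : DecidablePred (HasMinDist (q := q) (n := n) d) := fun C =>
  inferInstanceAs (Decidable (∀ x ∈ C, ∀ y ∈ C, x ≠ y → d ≤ hammingDist x y))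

/-- The collection of all `q`-ary codes of length `n` with minimum distance at least `d`. -/
def codes (q n d : ℕ) : Finset (Finset (Word q n)) :=
  Finset.univ.filter fun C => HasMinDist d C

/-- `A_q(n, d)`: the largest size of a `q`-ary code of length `n` with minimum distance
at least `d`. -/
def maxSize (q n d : ℕ) : ℕ := (codes q n d).sup Finset.card

/-- `vol_q(n, r)`: the number of words in a Hamming ball of radius `r` in the space of `q`-ary
words of length `n` (for `q ≥ 1`). -/
def vol (q n r : ℕ) : ℕ := ∑ i ∈ Finset.range (r + 1), n.choose i * (q - 1) ^ i

end QaryCode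

/-! ### Independent sets in triangle-free graphs. -/

namespace QaryCode
open Finset

/-! Write `N = q ^ n` and `B = vol q n d`. Codes of minimum distance at least `d + 1` are the
independent sets of the graph joining words at distance at most `d`. Its degrees are about `B`, so a
greedy choice gives only `N / B`; the extra factor `n` comes from local sparsity.

A triangle-free graph on `m` vertices with degrees at most `D` has an independent set of order `m *
log D / D` (`exists_large_indepSet`, by averaging a local occupancy over all independent sets). Take
`D` exponential in `n` with a small rate, and sample `m ≈ N * D / B` words at random. Typical
degrees in the sample are of order `D` and triangles are few, so deleting bad indices leaves the
triangle-free case (`exists_indep_indices`). Thus at least half of the samples contain a code of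
size `k` of order `n * N / B`.

A given `k`-set lies in the image of at most a fraction `(m / N) ^ k` of the samples, so there are
at least `(N / m) ^ k / 2` such codes (`card_pow_le_card_indep`). As `N / m ≈ B / D` is exponential
in `n`, this is `exp (Ω (n * k))`.

Triangles are rare (`exists_sparsity_rate`) because two typical words of a ball of radius `p * n`
differ in a proportion `P > p` of the coordinates, precisely when `p < (q - 1) / q`. An exponential
moment bound turns this into an exponential saving. -/

/-- The number of pairs `(y, Y)` with `y ∈ Y ⊆ X`, doubled. -/
theorem two_mul_sum_card_powerset {α : Type*} [DecidableEq α] (X : Finset α) :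
    2 * ∑ Y ∈ X.powerset, Y.card = X.card * 2 ^ X.card := by
  have h : ∑ Y ∈ X.powerset, (X \ Y).card = ∑ Y ∈ X.powerset, Y.card := by
    refine Finset.sum_nbij' (fun Y => X \ Y) (fun Y => X \ Y) ?_ ?_ ?_ ?_ ?_
    · intro Y _; simp
    · intro Y _; simp
    · intro Y hY; simpa using hY
    · intro Y hY; simpa using hY
    · intro Y _; rfl
  have h2 : ∑ Y ∈ X.powerset, (Y.card + (X \ Y).card) = X.card * 2 ^ X.card := by
    rw [Finset.sum_congr rfl (g := fun _ => X.card)]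
    · simp [mul_comm]
    · intro Y hY
      rw [add_comm, Finset.card_sdiff_add_card_eq_card (by simpa using hY)]
  rw [Finset.sum_add_distrib, h] at h2
  omega

/-- Either `x ≥ 4 * L` and the term `x * 2 ^ x` suffices, or `2 ^ x ≤ 16 ^ L` and `D ≥ 32 ^ L ≥ 2 *
L * 16 ^ L` does. It is the comparison needed on a fibre with `x` free neighbours, doubled to avoid
`2 ^ (x - 1)`. -/
theorem occupancy_bound {D L : ℕ} (hL : 32 ^ L ≤ D) (x : ℕ) :
    2 * L * (2 ^ x + 1) ≤ 2 * D + x * 2 ^ x := by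
  have hx1 : 1 ≤ 2 ^ x := Nat.one_le_two_pow
  rcases le_or_gt (4 * L) x with h | h
  · have : 4 * L * 2 ^ x ≤ x * 2 ^ x := Nat.mul_le_mul_right _ h
    nlinarith
  · have h1 : 2 ^ x ≤ 16 ^ L := by
      rw [show (16 : ℕ) = 2 ^ 4 by norm_num, ← pow_mul]
      exact Nat.pow_le_pow_right (by norm_num) h.le
    have h2 : 2 * L ≤ 2 ^ L := by
      clear h h1 hL
      induction L with
      | zero => simp
      | succ k ih =>
        rcases k with _ | k
        · simp
        · rw [pow_succ]; omega
    have h3 : 2 * L * 16 ^ L ≤ 32 ^ L := by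
      rw [show (32 : ℕ) = 2 * 16 by norm_num, mul_pow]
      exact Nat.mul_le_mul_right _ h2
    nlinarith

variable {V : Type*} [Fintype V] [DecidableEq V]

/-- The independent sets of a graph. -/
def indepSets (G : SimpleGraph V) [DecidableRel G.Adj] : Finset (Finset V) :=
  univ.filter fun W => ∀ x ∈ W, ∀ y ∈ W, ¬ G.Adj x y

theorem mem_indepSets {G : SimpleGraph V} [DecidableRel G.Adj] {W : Finset V} :
    W ∈ indepSets G ↔ ∀ x ∈ W, ∀ y ∈ W, ¬ G.Adj x y := by
  simp [indepSets]

/-- The occupancy of a vertex and its neighbourhood, averaged over the independent sets with a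
prescribed trace outside the closed neighbourhood. -/
theorem sum_fiber_occupancy (G : SimpleGraph V) [DecidableRel G.Adj] {D L : ℕ}
    (htri : ∀ a b c, G.Adj a b → G.Adj b c → G.Adj a c → False) (hL : 32 ^ L ≤ D) (v : V)
    (S : Finset V) :
    L * ((indepSets G).filter fun W => W \ insert v (G.neighborFinset v) = S).card ≤
      ∑ W ∈ (indepSets G).filter fun W => W \ insert v (G.neighborFinset v) = S,
        (D * (if v ∈ W then 1 else 0) + (W ∩ G.neighborFinset v).card) := by
  set F := (indepSets G).filter fun W => W \ insert v (G.neighborFinset v) = S with hF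
  rcases F.eq_empty_or_nonempty with h0 | ⟨W₀, hW₀⟩
  · simp [h0]
  have hF' : ∀ W, W ∈ F ↔ (∀ x ∈ W, ∀ y ∈ W, ¬ G.Adj x y) ∧
      W \ insert v (G.neighborFinset v) = S := by
    intro W; simp [hF, mem_indepSets]
  obtain ⟨hW1, hW2⟩ := (hF' W₀).1 hW₀
  have hSv : v ∉ S := by rw [← hW2]; simp
  have hSN : ∀ x ∈ S, ¬ G.Adj v x := by
    intro x hx; rw [← hW2] at hx; simp at hx; tauto
  have hSi : ∀ x ∈ S, ∀ y ∈ S, ¬ G.Adj x y := by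
    intro x hx y hy; rw [← hW2] at hx hy
    exact hW1 x (by simp at hx; tauto) y (by simp at hy; tauto)
  -- The neighbours of `v` left free by `S`. Since `N(v)` is independent, the fibre is exactly
  -- `insert v S` together with all `S ∪ Y`, `Y ⊆ X`: it has `1 + 2 ^ X.card` members.
  set X := (G.neighborFinset v).filter fun u => ∀ s ∈ S, ¬ G.Adj u s with hX
  have hA : F.filter (fun W => v ∈ W) = {insert v S} := by
    ext W
    simp only [mem_filter, hF', mem_singleton]
    constructor
    · rintro ⟨⟨hi, he⟩, hv⟩
      ext x
      rw [← he]
      by_cases hxv : x = v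
      · simp [hxv, hv]
      · have := hi v hv x
        simp [hxv]; tauto
    · rintro rfl
      refine ⟨⟨?_, ?_⟩, by simp⟩
      · intro x hx y hy hxy
        rcases mem_insert.1 hx with rfl | hx' <;> rcases mem_insert.1 hy with rfl | hy'
        · exact G.loopless.irrefl _ hxy
        · exact hSN _ hy' hxy
        · exact hSN _ hx' hxy.symm
        · exact hSi _ hx' _ hy' hxy
      · ext x
        by_cases hxv : x = v
        · simp [hxv, hSv]
        · have := hSN x
          simp [hxv]; tauto
  have hmaps : ∀ Y ∈ X.powerset, S ∪ Y ∈ F.filter (fun W => v ∉ W) := by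
    intro Y hY
    have hY' : ∀ y ∈ Y, G.Adj v y ∧ ∀ s ∈ S, ¬ G.Adj y s := by
      intro y hy
      have := mem_powerset.1 hY hy
      simpa [hX] using this
    have hvY : v ∉ Y := fun h => G.loopless.irrefl _ (hY' v h).1
    simp only [mem_filter, hF']
    refine ⟨⟨?_, ?_⟩, by simp [hSv, hvY]⟩
    · intro x hx y hy hxy
      rcases mem_union.1 hx with hx | hx <;> rcases mem_union.1 hy with hy | hy
      · exact hSi _ hx _ hy hxy
      · exact (hY' _ hy).2 _ hx hxy.symm
      · exact (hY' _ hx).2 _ hy hxy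
      · exact htri _ _ _ (hY' _ hx).1 hxy (hY' _ hy).1
    · ext x
      by_cases hxv : x = v
      · simp [hxv, hSv]
      · have := hSN x
        have := hY' x
        simp [hxv]; tauto
  have hinter : ∀ Y ∈ X.powerset, (S ∪ Y) ∩ G.neighborFinset v = Y := by
    intro Y hY
    ext x
    have h1 : x ∈ Y → G.Adj v x := fun hy => by
      have := mem_powerset.1 hY hy
      simp [hX] at this; exact this.1
    have := hSN x
    simp; tauto
  have hback : ∀ W ∈ F.filter (fun W => v ∉ W), W ∩ G.neighborFinset v ∈ X.powerset ∧
      S ∪ (W ∩ G.neighborFinset v) = W := by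
    intro W hW
    simp only [mem_filter, hF'] at hW
    obtain ⟨⟨hi, he⟩, hv⟩ := hW
    constructor
    · rw [mem_powerset]
      intro u hu
      simp only [mem_inter, SimpleGraph.mem_neighborFinset] at hu
      simp only [hX, mem_filter, SimpleGraph.mem_neighborFinset]
      refine ⟨hu.2, fun s hs => hi u hu.1 s ?_⟩
      rw [← he] at hs; exact (mem_sdiff.1 hs).1
    · ext x
      rw [← he]
      by_cases hxv : x = v
      · simp [hxv, hv]
      · simp [hxv]; tauto
  have hcardB : (F.filter (fun W => v ∉ W)).card = 2 ^ X.card := by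
    rw [← card_powerset]
    exact Finset.card_nbij' (fun W => W ∩ G.neighborFinset v) (fun Y => S ∪ Y)
      (fun W hW => (hback W hW).1) hmaps (fun W hW => (hback W hW).2) hinter
  have hsumB : ∑ W ∈ F.filter (fun W => v ∉ W), (W ∩ G.neighborFinset v).card =
      ∑ Y ∈ X.powerset, Y.card :=
    Finset.sum_nbij' (fun W => W ∩ G.neighborFinset v) (fun Y => S ∪ Y)
      (fun W hW => (hback W hW).1) hmaps (fun W hW => (hback W hW).2) hinter (fun _ _ => rfl)
  have hcard : F.card = 1 + 2 ^ X.card := by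
    rw [← hcardB, ← Finset.card_filter_add_card_filter_not (s := F) (fun W => v ∈ W), hA]
    simp
  have hsum : D + ∑ Y ∈ X.powerset, Y.card ≤
      ∑ W ∈ F, (D * (if v ∈ W then 1 else 0) + (W ∩ G.neighborFinset v).card) := by
    rw [← Finset.sum_filter_add_sum_filter_not F (fun W => v ∈ W), hA, ← hsumB]
    refine Nat.add_le_add (by simp) (Finset.sum_le_sum fun W _ => by simp)
  have h1 := two_mul_sum_card_powerset X
  have h2 := occupancy_bound hL X.card
  rw [hcard]
  nlinarith

/-- A triangle-free graph of maximum degree at most `D` on `N` vertices has an independent set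
of size at least `L * N / (2 * D)`, whenever `32 ^ L ≤ D`. -/
theorem exists_large_indepSet (G : SimpleGraph V) [DecidableRel G.Adj] {D L : ℕ}
    (htri : ∀ a b c, G.Adj a b → G.Adj b c → G.Adj a c → False)
    (hdeg : ∀ v, G.degree v ≤ D) (hL : 32 ^ L ≤ D) :
    ∃ W : Finset V, (∀ x ∈ W, ∀ y ∈ W, ¬ G.Adj x y) ∧ L * Fintype.card V ≤ 2 * D * W.card := by
  have hv : ∀ v : V, L * (indepSets G).card ≤
      ∑ W ∈ indepSets G, (D * (if v ∈ W then 1 else 0) + (W ∩ G.neighborFinset v).card) := by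
    intro v
    rw [Finset.card_eq_sum_card_fiberwise (t := univ)
      (f := fun W => W \ insert v (G.neighborFinset v)) (fun _ _ => by simp), Finset.mul_sum,
      ← Finset.sum_fiberwise (indepSets G) (fun W => W \ insert v (G.neighborFinset v))]
    exact Finset.sum_le_sum fun S _ => sum_fiber_occupancy G htri hL v S
  -- Double count: each `w ∈ W` contributes `D` at `v = w` and `1` at each of its at most `D`
  -- neighbours.
  have hW : ∀ W : Finset V,
      ∑ v, (D * (if v ∈ W then 1 else 0) + (W ∩ G.neighborFinset v).card) ≤ 2 * D * W.card := by
    intro W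
    have h1 : ∑ v, (W ∩ G.neighborFinset v).card = ∑ w ∈ W, G.degree w := by
      have : ∀ v, (W ∩ G.neighborFinset v).card = ∑ w ∈ W, if G.Adj v w then 1 else 0 := by
        intro v
        rw [Finset.sum_boole, Nat.cast_id]
        congr 1
        ext x; simp
      simp_rw [this]
      rw [Finset.sum_comm]
      refine Finset.sum_congr rfl fun w _ => ?_
      rw [Finset.sum_boole, Nat.cast_id, ← SimpleGraph.card_neighborFinset_eq_degree]
      congr 1
      ext x; simp [SimpleGraph.adj_comm]
    have h2 : ∑ w ∈ W, G.degree w ≤ W.card * D := by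
      simpa using Finset.sum_le_card_nsmul W _ D (fun w _ => hdeg w)
    rw [Finset.sum_add_distrib, h1, ← Finset.mul_sum]
    simp only [Finset.sum_ite_mem, Finset.univ_inter, Finset.sum_const, smul_eq_mul, mul_one]
    nlinarith
  by_contra! hcon
  have hne : (indepSets G).Nonempty := ⟨∅, by simp [mem_indepSets]⟩
  have h1 : ∑ v : V, L * (indepSets G).card ≤ ∑ W ∈ indepSets G, 2 * D * W.card := by
    refine (Finset.sum_le_sum fun v _ => hv v).trans ?_
    rw [Finset.sum_comm]
    exact Finset.sum_le_sum fun W _ => hW W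
  have h2 : ∑ W ∈ indepSets G, 2 * D * W.card < ∑ W ∈ indepSets G, L * Fintype.card V :=
    Finset.sum_lt_sum_of_nonempty hne fun W h => hcon W (mem_indepSets.1 h)
  simp only [Finset.sum_const, smul_eq_mul, card_univ] at h1 h2
  nlinarith

end QaryCode

/-! ### Random samples and the counting of independent sets. -/

namespace QaryCode
open Finset

/-- The number of maps whose restriction along an injection satisfies a given property. -/
theorem card_filter_comp {A M V : Type*} [Fintype A] [Fintype M] [Fintype V] [DecidableEq A]
    [DecidableEq M] (σ : A ↪ M) (P : (A → V) → Prop) [DecidablePred P] :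
    Fintype.card V ^ Fintype.card A * (univ.filter fun f : M → V => P (f ∘ σ)).card =
      (univ.filter P).card * Fintype.card V ^ Fintype.card M := by
  classical
  let e : (M → V) ≃ (A → V) × ({i : M // i ∉ Set.range σ} → V) :=
    (Equiv.piEquivPiSubtypeProd (fun i => i ∈ Set.range σ) (fun _ => V)).trans
      ((Equiv.arrowCongr (Equiv.ofInjective σ σ.injective).symm (Equiv.refl V)).prodCongr
        (Equiv.refl _))
  have he : ∀ f, (e f).1 = f ∘ σ := fun f => rfl
  have h1 : (univ.filter fun f : M → V => P (f ∘ σ)).card =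
      ((univ.filter P) ×ˢ (univ : Finset ({i : M // i ∉ Set.range σ} → V))).card :=
    Finset.card_equiv e fun f => by simp [he]
  have h2 := Fintype.card_congr e
  rw [Fintype.card_prod, Fintype.card_fun, Fintype.card_fun] at h2
  rw [h1, card_product, h2, card_univ]
  ring

section Sampling

variable {V : Type*} [Fintype V] (R : V → V → Prop) [DecidableRel R]

/-- The pairs of indices whose samples are related. -/
def relPairs {m : ℕ} (f : Fin m → V) : Finset (Fin m × Fin m) :=
  univ.filter fun e => e.1 ≠ e.2 ∧ R (f e.1) (f e.2)

/-- The triples of distinct indices whose samples are pairwise related. -/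
def relTriples {m : ℕ} (f : Fin m → V) : Finset (Fin m × Fin m × Fin m) :=
  univ.filter fun e => (e.1 ≠ e.2.1 ∧ e.2.1 ≠ e.2.2 ∧ e.1 ≠ e.2.2) ∧
    R (f e.1) (f e.2.1) ∧ R (f e.2.1) (f e.2.2) ∧ R (f e.1) (f e.2.2)

/-- Linearity of expectation: the samples at two distinct indices form a uniform pair. Denominators
are cleared to stay in `ℕ`. -/
theorem sum_card_relPairs_le (m : ℕ) :
    Fintype.card V ^ 2 * ∑ f : Fin m → V, (relPairs R f).card ≤
      m ^ 2 * ((univ.filter fun x : V × V => R x.1 x.2).card * Fintype.card V ^ m) := by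
  have h : ∑ f : Fin m → V, (relPairs R f).card = ∑ e : Fin m × Fin m,
      (univ.filter fun f : Fin m → V => e.1 ≠ e.2 ∧ R (f e.1) (f e.2)).card := by
    simp_rw [relPairs, Finset.card_filter]
    exact Finset.sum_comm
  rw [h, Finset.mul_sum]
  have hb : ∀ e ∈ (univ : Finset (Fin m × Fin m)), Fintype.card V ^ 2 *
      (univ.filter fun f : Fin m → V => e.1 ≠ e.2 ∧ R (f e.1) (f e.2)).card ≤
      (univ.filter fun x : V × V => R x.1 x.2).card * Fintype.card V ^ m := by
    rintro ⟨i, j⟩ -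
    by_cases hij : i = j
    · simp [hij]
    have hσ : Function.Injective ![i, j] := by
      intro a b hab
      fin_cases a <;> fin_cases b <;> simp_all [eq_comm]
    have := card_filter_comp (V := V) ⟨![i, j], hσ⟩ (fun g => R (g 0) (g 1))
    have hc : (univ.filter fun g : Fin 2 → V => R (g 0) (g 1)).card =
        (univ.filter fun x : V × V => R x.1 x.2).card :=
      Finset.card_equiv (finTwoArrowEquiv V) fun g => by simp
    rw [hc, Fintype.card_fin, Fintype.card_fin] at this
    simpa [hij] using this.le
  refine (Finset.sum_le_card_nsmul _ _ _ hb).trans (le_of_eq ?_)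
  simp [sq]

theorem sum_card_relTriples_le (m : ℕ) :
    Fintype.card V ^ 3 * ∑ f : Fin m → V, (relTriples R f).card ≤
      m ^ 3 * ((univ.filter fun x : V × V × V =>
        R x.1 x.2.1 ∧ R x.2.1 x.2.2 ∧ R x.1 x.2.2).card * Fintype.card V ^ m) := by
  have h : ∑ f : Fin m → V, (relTriples R f).card = ∑ e : Fin m × Fin m × Fin m,
      (univ.filter fun f : Fin m → V => (e.1 ≠ e.2.1 ∧ e.2.1 ≠ e.2.2 ∧ e.1 ≠ e.2.2) ∧
        R (f e.1) (f e.2.1) ∧ R (f e.2.1) (f e.2.2) ∧ R (f e.1) (f e.2.2)).card := by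
    simp_rw [relTriples, Finset.card_filter]
    exact Finset.sum_comm
  rw [h, Finset.mul_sum]
  have hb : ∀ e ∈ (univ : Finset (Fin m × Fin m × Fin m)), Fintype.card V ^ 3 *
      (univ.filter fun f : Fin m → V => (e.1 ≠ e.2.1 ∧ e.2.1 ≠ e.2.2 ∧ e.1 ≠ e.2.2) ∧
        R (f e.1) (f e.2.1) ∧ R (f e.2.1) (f e.2.2) ∧ R (f e.1) (f e.2.2)).card ≤
      (univ.filter fun x : V × V × V =>
        R x.1 x.2.1 ∧ R x.2.1 x.2.2 ∧ R x.1 x.2.2).card * Fintype.card V ^ m := by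
    rintro ⟨i, j, l⟩ -
    by_cases hd : i ≠ j ∧ j ≠ l ∧ i ≠ l
    swap
    · simp [hd]
    obtain ⟨hij, hjl, hil⟩ := id hd
    have hσ : Function.Injective ![i, j, l] := by
      intro a b hab
      fin_cases a <;> fin_cases b <;> simp_all [eq_comm]
    have := card_filter_comp (V := V) ⟨![i, j, l], hσ⟩
      (fun g => R (g 0) (g 1) ∧ R (g 1) (g 2) ∧ R (g 0) (g 2))
    have hc : (univ.filter fun g : Fin 3 → V => R (g 0) (g 1) ∧ R (g 1) (g 2) ∧ R (g 0) (g 2)).card =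
        (univ.filter fun x : V × V × V => R x.1 x.2.1 ∧ R x.2.1 x.2.2 ∧ R x.1 x.2.2).card :=
      Finset.card_nbij' (fun g => (g 0, g 1, g 2)) (fun x => ![x.1, x.2.1, x.2.2])
        (fun g hg => by simpa using hg) (fun x hx => by simpa using hx)
        (fun g _ => by ext a; fin_cases a <;> rfl) (fun x _ => rfl)
    rw [hc, Fintype.card_fin, Fintype.card_fin] at this
    refine le_of_eq_of_le ?_ this.le
    exact congrArg (Fintype.card V ^ 3 * ·) (congrArg card
      (Finset.filter_congr fun f _ => by simp [hij, hjl, hil]))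
  refine (Finset.sum_le_card_nsmul _ _ _ hb).trans (le_of_eq ?_)
  simp only [card_univ, Fintype.card_prod, Fintype.card_fin, smul_eq_mul]
  ring

/-- Most maps `f` have few related pairs and few related triples. -/
theorem card_le_two_mul_card_sparse {m D : ℕ} (hV : 0 < Fintype.card V) (hm : 0 < m) (hD : 0 < D)
    (hE : 16 * m * (univ.filter fun x : V × V => R x.1 x.2).card ≤ Fintype.card V ^ 2 * D)
    (hT : 16 * m ^ 2 * (univ.filter fun x : V × V × V =>
      R x.1 x.2.1 ∧ R x.2.1 x.2.2 ∧ R x.1 x.2.2).card ≤ Fintype.card V ^ 3) :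
    Fintype.card V ^ m ≤ 2 * (univ.filter fun f : Fin m → V =>
      4 * (relPairs R f).card ≤ m * D ∧ 4 * (relTriples R f).card ≤ m).card := by
  classical
  set E := (univ.filter fun x : V × V => R x.1 x.2).card
  set T := (univ.filter fun x : V × V × V =>
      R x.1 x.2.1 ∧ R x.2.1 x.2.2 ∧ R x.1 x.2.2).card
  -- By Markov, each of the two conditions fails for at most a quarter of the maps: the means are at
  -- most `m * D / 16` and `m / 16`, the thresholds four times larger.
  set N := Fintype.card V
  set b₁ := (univ.filter fun f : Fin m → V => m * D < 4 * (relPairs R f).card).card with hb₁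
  set b₂ := (univ.filter fun f : Fin m → V => m < 4 * (relTriples R f).card).card with hb₂
  have h1 : b₁ * (m * D) ≤ 4 * ∑ f : Fin m → V, (relPairs R f).card := by
    rw [Finset.mul_sum]
    refine le_trans ?_ (Finset.sum_le_sum_of_subset
      (Finset.filter_subset (fun f : Fin m → V => m * D < 4 * (relPairs R f).card) univ))
    simpa using Finset.card_nsmul_le_sum _ _ (m * D)
      (fun f (hf : f ∈ univ.filter fun f : Fin m → V => m * D < 4 * (relPairs R f).card) =>
        (mem_filter.1 hf).2.le)
  have h2 : b₂ * m ≤ 4 * ∑ f : Fin m → V, (relTriples R f).card := by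
    rw [Finset.mul_sum]
    refine le_trans ?_ (Finset.sum_le_sum_of_subset
      (Finset.filter_subset (fun f : Fin m → V => m < 4 * (relTriples R f).card) univ))
    simpa using Finset.card_nsmul_le_sum _ _ m
      (fun f (hf : f ∈ univ.filter fun f : Fin m → V => m < 4 * (relTriples R f).card) =>
        (mem_filter.1 hf).2.le)
  have h3 : 4 * b₁ ≤ N ^ m := by
    have := sum_card_relPairs_le R m
    refine Nat.le_of_mul_le_mul_left (c := N ^ 2 * (m * D)) ?_ (by positivity)
    calc N ^ 2 * (m * D) * (4 * b₁) = 4 * (N ^ 2 * (b₁ * (m * D))) := by ring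
      _ ≤ 4 * (N ^ 2 * (4 * ∑ f : Fin m → V, (relPairs R f).card)) := by gcongr
      _ = 16 * (N ^ 2 * ∑ f : Fin m → V, (relPairs R f).card) := by ring
      _ ≤ 16 * (m ^ 2 * (E * N ^ m)) := by gcongr
      _ = m * N ^ m * (16 * m * E) := by ring
      _ ≤ m * N ^ m * (N ^ 2 * D) := by gcongr
      _ = N ^ 2 * (m * D) * N ^ m := by ring
  have h4 : 4 * b₂ ≤ N ^ m := by
    have := sum_card_relTriples_le R m
    refine Nat.le_of_mul_le_mul_left (c := N ^ 3 * m) ?_ (by positivity)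
    calc N ^ 3 * m * (4 * b₂) = 4 * (N ^ 3 * (b₂ * m)) := by ring
      _ ≤ 4 * (N ^ 3 * (4 * ∑ f : Fin m → V, (relTriples R f).card)) := by gcongr
      _ = 16 * (N ^ 3 * ∑ f : Fin m → V, (relTriples R f).card) := by ring
      _ ≤ 16 * (m ^ 3 * (T * N ^ m)) := by gcongr
      _ = m * N ^ m * (16 * m ^ 2 * T) := by ring
      _ ≤ m * N ^ m * N ^ 3 := by gcongr
      _ = N ^ 3 * m * N ^ m := by ring
  have h5 : N ^ m ≤ (univ.filter fun f : Fin m → V =>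
      4 * (relPairs R f).card ≤ m * D ∧ 4 * (relTriples R f).card ≤ m).card + b₁ + b₂ := by
    have : (univ : Finset (Fin m → V)).card = N ^ m := by simp [N]
    rw [← this, hb₁, hb₂]
    refine le_trans (card_le_card ?_) ((card_union_le _ _).trans
      (Nat.add_le_add_right (card_union_le _ _) _))
    intro f _
    simp only [mem_union, mem_filter, mem_univ, true_and]
    omega
  omega

/-- A sparse sample contains a large independent set of indices. -/
theorem exists_indep_indices {V : Type*} (R : V → V → Prop) [DecidableRel R]
    (hsymm : ∀ x y, R x y → R y x) {m D L k : ℕ}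
    (hL : 32 ^ L ≤ D) (hk : 4 * D * (k - 1) < L * m) (f : Fin m → V)
    (hE : 4 * (relPairs R f).card ≤ m * D) (hT : 4 * (relTriples R f).card ≤ m) :
    ∃ S : Finset (Fin m), S.card = k ∧ ∀ i ∈ S, ∀ j ∈ S, i ≠ j → ¬ R (f i) (f j) := by
  have hD : 0 < D := lt_of_lt_of_le (by positivity) hL
  let G : SimpleGraph (Fin m) :=
    { Adj := fun i j => i ≠ j ∧ R (f i) (f j)
      symm := ⟨fun i j h => ⟨h.1.symm, hsymm _ _ h.2⟩⟩
      loopless := ⟨fun i h => h.1 rfl⟩ }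
  have : DecidableRel G.Adj := Classical.decRel _
  -- Deleting the indices of large degree (`B₁`) and those on triangles (`B₂`) costs at most `m / 4`
  -- each.
  set B₁ := univ.filter fun i : Fin m => D < G.degree i with hB₁
  set B₂ := (relTriples R f).image Prod.fst with hB₂
  have h1 : B₁.card * D ≤ (relPairs R f).card := by
    have hs : (relPairs R f).card = ∑ i, G.degree i := by
      rw [Finset.card_eq_sum_card_fiberwise (t := univ) (f := Prod.fst) (fun _ _ => by simp)]
      refine Finset.sum_congr rfl fun i _ => ?_
      rw [← SimpleGraph.card_neighborFinset_eq_degree]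
      refine Finset.card_nbij' Prod.snd (fun j => (i, j)) ?_ ?_ ?_ ?_
      · rintro ⟨a, b⟩ h
        simp [relPairs] at h
        obtain ⟨h, rfl⟩ := h
        simpa [G] using h
      · intro j h
        simpa [relPairs, G] using h
      · rintro ⟨a, b⟩ h
        simp [relPairs] at h
        simp [h.2]
      · intro j _; rfl
    rw [hs]
    refine le_trans ?_ (Finset.sum_le_sum_of_subset (Finset.subset_univ B₁))
    simpa using Finset.card_nsmul_le_sum B₁ _ D (fun i hi => (mem_filter.1 hi).2.le)
  have h2 : B₂.card ≤ (relTriples R f).card := card_image_le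
  have h3 : 4 * B₁.card ≤ m := by nlinarith
  set U := univ \ (B₁ ∪ B₂) with hU
  have hUc : m ≤ 2 * U.card := by
    have ha : U.card + (B₁ ∪ B₂).card = (univ ∪ (B₁ ∪ B₂)).card :=
      Finset.card_sdiff_add_card _ _
    have hb := card_union_le B₁ B₂
    have hc := card_le_card (Finset.subset_union_left (s₁ := (univ : Finset (Fin m)))
      (s₂ := B₁ ∪ B₂))
    rw [card_univ, Fintype.card_fin] at hc
    omega
  have hUm : ∀ i : U, i.1 ∉ B₁ ∧ i.1 ∉ B₂ := by
    rintro ⟨i, hi⟩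
    simpa [hU] using hi
  let H : SimpleGraph U := G.comap Subtype.val
  have : DecidableRel H.Adj := Classical.decRel _
  obtain ⟨W, hW, hWc⟩ := exists_large_indepSet H (D := D) (L := L) (by
      rintro a b c hab hbc hac
      refine (hUm a).2 ?_
      rw [hB₂, mem_image]
      refine ⟨(a.1, b.1, c.1), ?_, rfl⟩
      simp only [relTriples, mem_filter, mem_univ, true_and]
      exact ⟨⟨hab.1, hbc.1, hac.1⟩, hab.2, hbc.2, hac.2⟩) (by
      intro v
      have hv : G.degree v.1 ≤ D := by simpa [hB₁] using (hUm v).1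
      refine le_trans ?_ hv
      rw [← SimpleGraph.card_neighborFinset_eq_degree, ← SimpleGraph.card_neighborFinset_eq_degree]
      refine Finset.card_le_card_of_injOn Subtype.val ?_ Subtype.val_injective.injOn
      intro w hw
      simpa [H] using hw) hL
  -- `L * U.card ≤ 2 * D * W.card` with `U.card ≥ m / 2`; strictness in `hk` gains the missing unit.
  have hkW : k ≤ W.card := by
    rw [Fintype.card_coe] at hWc
    have : L * m ≤ 4 * D * W.card := by nlinarith
    have h6 : 4 * D * (k - 1) < 4 * D * W.card := lt_of_lt_of_le hk this
    have := Nat.lt_of_mul_lt_mul_left h6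
    omega
  obtain ⟨W', hW'W, hW'c⟩ := Finset.exists_subset_card_eq hkW
  refine ⟨W'.map (Function.Embedding.subtype _), by simpa using hW'c, ?_⟩
  intro i hi j hj hij hR
  obtain ⟨a, ha, rfl⟩ := mem_map.1 hi
  obtain ⟨b, hb, rfl⟩ := mem_map.1 hj
  exact hW a (hW'W ha) b (hW'W hb) ⟨hij, hR⟩

/-- A reflexive symmetric relation with few related pairs and very few pairwise related triples
has many independent sets of size `k`. -/
theorem card_pow_le_card_indep [DecidableEq V] (hrefl : ∀ x, R x x) (hsymm : ∀ x y, R x y → R y x) {m D L k : ℕ}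
    (hV : 0 < Fintype.card V) (hm : 0 < m)
    (hE : 16 * m * (univ.filter fun x : V × V => R x.1 x.2).card ≤ Fintype.card V ^ 2 * D)
    (hT : 16 * m ^ 2 * (univ.filter fun x : V × V × V =>
      R x.1 x.2.1 ∧ R x.2.1 x.2.2 ∧ R x.1 x.2.2).card ≤ Fintype.card V ^ 3)
    (hL : 32 ^ L ≤ D) (hk : 4 * D * (k - 1) < L * m) :
    Fintype.card V ^ k ≤ 2 * (m ^ k * (univ.filter fun C : Finset V =>
      C.card = k ∧ ∀ x ∈ C, ∀ y ∈ C, x ≠ y → ¬ R x y).card) := by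
  have hD : 0 < D := lt_of_lt_of_le (by positivity) hL
  set N := Fintype.card V
  set I := univ.filter fun C : Finset V => C.card = k ∧ ∀ x ∈ C, ∀ y ∈ C, x ≠ y → ¬ R x y with hI
  set good := univ.filter fun f : Fin m → V =>
      4 * (relPairs R f).card ≤ m * D ∧ 4 * (relTriples R f).card ≤ m with hgood
  have h1 : N ^ m ≤ 2 * good.card := card_le_two_mul_card_sparse R hV hm hD hE hT
  -- A good map `f` has some `C ∈ I` in its image, hence a section `h` of `f` over `C`. There are at
  -- most `m ^ k` choices of `h`, and each fixes `f` at `k` indices.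
  have hsub : good ⊆ I.biUnion fun C => (univ : Finset (C ↪ Fin m)).biUnion fun h =>
      univ.filter fun f : Fin m → V => f ∘ h = Subtype.val := by
    intro f hf
    obtain ⟨-, hf1, hf2⟩ := mem_filter.1 hf
    obtain ⟨S, hSk, hS⟩ := exists_indep_indices R hsymm hL hk f hf1 hf2
    -- Reflexivity of `R` forbids repeated samples, so the code really has `k` words.
    have hinj : Set.InjOn f S := by
      intro i hi j hj hij
      by_contra hne
      exact hS i hi j hj hne (hij ▸ hrefl _)
    have hsurj : ∀ c : S.image f, ∃ i ∈ S, f i = c := fun c => mem_image.1 c.2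
    choose g hgS hg using hsurj
    simp only [mem_biUnion, mem_filter, mem_univ, true_and]
    refine ⟨S.image f, ?_, ⟨g, fun a b hab => Subtype.ext (by rw [← hg a, ← hg b, hab])⟩,
      funext hg⟩
    simp only [hI, mem_filter, mem_univ, true_and]
    refine ⟨by rw [card_image_of_injOn hinj, hSk], ?_⟩
    intro x hx y hy hxy
    obtain ⟨i, hi, rfl⟩ := mem_image.1 hx
    obtain ⟨j, hj, rfl⟩ := mem_image.1 hy
    exact hS i hi j hj (fun h => hxy (h ▸ rfl))
  have h2 : N ^ k * good.card ≤ I.card * (m ^ k * N ^ m) := by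
    calc N ^ k * good.card ≤ N ^ k * ∑ C ∈ I, ∑ h : C ↪ Fin m,
          (univ.filter fun f : Fin m → V => f ∘ h = Subtype.val).card := by
          gcongr
          exact (card_le_card hsub).trans (card_biUnion_le.trans
            (Finset.sum_le_sum fun C _ => card_biUnion_le))
      _ = ∑ C ∈ I, ∑ h : C ↪ Fin m,
          N ^ k * (univ.filter fun f : Fin m → V => f ∘ h = Subtype.val).card := by
          simp_rw [Finset.mul_sum]
      _ ≤ ∑ C ∈ I, m ^ k * N ^ m := by
          refine Finset.sum_le_sum fun C hC => ?_
          have hCk : C.card = k := (mem_filter.1 hC).2.1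
          have hone : ∀ h : C ↪ Fin m,
              N ^ k * (univ.filter fun f : Fin m → V => f ∘ h = Subtype.val).card = N ^ m := by
            intro h
            have := card_filter_comp (V := V) h (fun g => g = Subtype.val)
            rw [Fintype.card_coe, hCk, Fintype.card_fin] at this
            rw [this]
            simp [N, Finset.filter_eq']
          rw [Finset.sum_congr rfl (fun h _ => hone h), Finset.sum_const, smul_eq_mul]
          gcongr
          rw [card_univ]
          calc Fintype.card (C ↪ Fin m) ≤ Fintype.card (C → Fin m) :=
                Fintype.card_le_of_injective _ DFunLike.coe_injective
            _ = m ^ k := by simp [hCk]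
      _ = I.card * (m ^ k * N ^ m) := by simp
  refine Nat.le_of_mul_le_mul_right (c := N ^ m) ?_ (by positivity)
  calc N ^ k * N ^ m ≤ N ^ k * (2 * good.card) := by gcongr
    _ = 2 * (N ^ k * good.card) := by ring
    _ ≤ 2 * (I.card * (m ^ k * N ^ m)) := by gcongr
    _ = 2 * (m ^ k * I.card) * N ^ m := by ring

end Sampling

end QaryCode

/-! ### Hamming balls and triangles of close words. -/

namespace QaryCode
open Finset

theorem vol_le (q n d : ℕ) (hq : 1 ≤ q) (hd : d ≤ n) : vol q n d ≤ q ^ n := by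
  have h : q ^ n = ∑ i ∈ range (n + 1), n.choose i * (q - 1) ^ i := by
    conv_lhs => rw [show q = (q - 1) + 1 by omega, add_pow]
    simp [mul_comm]
  rw [h, vol]
  exact Finset.sum_le_sum_of_subset (by simpa using hd)

theorem one_le_vol (q n d : ℕ) : 1 ≤ vol q n d := by
  rw [vol, Finset.sum_range_succ']
  simp

/-- The Hamming ball of radius `d` about any word has `vol q n d` elements. -/
theorem card_ball (q n d : ℕ) (x : Word q n) :
    (univ.filter fun y : Word q n => hammingDist x y ≤ d).card = vol q n d := by
  have hfib : ∀ A : Finset (Fin n),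
      (univ.filter fun y : Word q n => (univ.filter fun i => x i ≠ y i) = A).card =
        (q - 1) ^ A.card := by
    intro A
    have : (univ.filter fun y : Word q n => (univ.filter fun i => x i ≠ y i) = A) =
        Fintype.piFinset fun i => if i ∈ A then univ.erase (x i) else {x i} := by
      ext y
      simp only [mem_filter, mem_univ, true_and, Fintype.mem_piFinset, Finset.ext_iff]
      refine forall_congr' fun i => ?_
      by_cases h : i ∈ A <;> simp [h, eq_comm]
    rw [this, Fintype.card_piFinset]
    have : ∀ i, (if i ∈ A then univ.erase (x i) else {x i}).card = if i ∈ A then q - 1 else 1 := by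
      intro i; split_ifs <;> simp
    simp_rw [this]
    simp
  have h1 : (univ.filter fun y : Word q n => hammingDist x y ≤ d).card =
      ∑ A ∈ univ.filter fun A : Finset (Fin n) => A.card ≤ d, (q - 1) ^ A.card := by
    rw [Finset.card_eq_sum_card_fiberwise (f := fun y => univ.filter fun i => x i ≠ y i)
      (t := univ.filter fun A : Finset (Fin n) => A.card ≤ d)
      (fun y hy => by simpa [hammingDist] using hy)]
    refine Finset.sum_congr rfl fun A hA => ?_
    rw [← hfib A, Finset.filter_filter]
    congr 1
    ext y
    simp only [mem_filter, mem_univ, true_and] at hA ⊢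
    refine ⟨fun h => h.2, fun h => ⟨?_, h⟩⟩
    rw [← h] at hA
    exact hA
  rw [h1, ← Finset.sum_fiberwise_of_maps_to (g := Finset.card) (t := range (d + 1))
    (fun A hA => by simpa [Nat.lt_succ_iff] using hA), vol]
  refine Finset.sum_congr rfl fun i hi => ?_
  have : ((univ.filter fun A : Finset (Fin n) => A.card ≤ d).filter fun A => A.card = i) =
      powersetCard i univ := by
    ext A
    simp only [mem_range] at hi
    simp only [mem_filter, mem_univ, true_and, mem_powersetCard, subset_univ]
    omega
  rw [this, Finset.sum_congr rfl (g := fun _ => (q - 1) ^ i)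
    (fun A hA => by rw [(mem_powersetCard.1 hA).2]), Finset.sum_const, card_powersetCard]
  simp

theorem card_close_pairs (q n d : ℕ) :
    (univ.filter fun x : Word q n × Word q n => hammingDist x.1 x.2 ≤ d).card =
      q ^ n * vol q n d := by
  rw [Finset.card_eq_sum_card_fiberwise (f := Prod.fst) (t := univ) (fun _ _ => by simp),
    Finset.sum_congr rfl (g := fun _ => vol q n d)]
  · simp
  · intro x _
    rw [← card_ball q n d x]
    refine Finset.card_nbij' Prod.snd (fun y => (x, y)) ?_ ?_ ?_ ?_
    · rintro ⟨a, b⟩ h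
      simp at h
      obtain ⟨h, rfl⟩ := h
      simpa using h
    · intro y h; simpa using h
    · rintro ⟨a, b⟩ h
      simp at h
      simp [h.2]
    · intro y _; rfl

/-- The generating function of the distances in a triangle, for words of length one. -/
theorem sum_triangle_weight (q : ℕ) (μ ν : ℝ) :
    ∑ t : Fin q × Fin q × Fin q, (if t.1 ≠ t.2.1 then μ else 1) *
        (if t.2.1 ≠ t.2.2 then ν else 1) * (if t.1 ≠ t.2.2 then μ else 1) =
      q * (ν * (1 + (q - 1) * μ) ^ 2 + (1 - ν) * (1 + (q - 1) * μ ^ 2)) := by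
  have hsum : ∀ (s : ℝ) (a : Fin q), ∑ b : Fin q, (if a ≠ b then s else 1) = 1 + (q - 1) * s := by
    intro s a
    have : ∀ b : Fin q, (if a ≠ b then s else 1) = s + if a = b then 1 - s else 0 := by
      intro b; by_cases h : a = b <;> simp [h]
    simp_rw [this, Finset.sum_add_distrib]
    simp
    ring
  have hin : ∀ a b : Fin q, ∑ c : Fin q, (if a ≠ b then μ else 1) *
      (if b ≠ c then ν else 1) * (if a ≠ c then μ else 1) =
      ν * (1 + (q - 1) * μ) * (if a ≠ b then μ else 1) + (1 - ν) * (if a ≠ b then μ ^ 2 else 1) := by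
    intro a b
    -- Split the middle weight as `ν + (1 - ν) * [b = c]`.
    have : ∀ c : Fin q, (if a ≠ b then μ else 1) * (if b ≠ c then ν else 1) *
        (if a ≠ c then μ else 1) = ν * (if a ≠ b then μ else 1) * (if a ≠ c then μ else 1) +
        if b = c then (1 - ν) * (if a ≠ b then μ else 1) * (if a ≠ b then μ else 1) else 0 := by
      intro c
      by_cases h : b = c
      · subst h; simp; split_ifs <;> ring
      · simp [h]; split_ifs <;> ring
    simp_rw [this, Finset.sum_add_distrib, ← Finset.mul_sum, hsum]
    simp only [Finset.sum_ite_eq, mem_univ, if_true]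
    split_ifs <;> ring
  simp_rw [Fintype.sum_prod_type, hin, Finset.sum_add_distrib, ← Finset.mul_sum, hsum]
  simp
  ring

/-- An exponential moment bound for the number of triples of words at pairwise distance at
most `d`. -/
theorem card_close_triples_le (q n d : ℕ) {μ ν : ℝ} (hμ0 : 0 < μ) (hμ1 : μ ≤ 1)
    (hν0 : 0 < ν) (hν1 : ν ≤ 1) :
    μ ^ (2 * d) * ν ^ d * ((univ.filter fun x : Word q n × Word q n × Word q n =>
        hammingDist x.1 x.2.1 ≤ d ∧ hammingDist x.2.1 x.2.2 ≤ d ∧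
          hammingDist x.1 x.2.2 ≤ d).card : ℝ) ≤
      (q * (ν * (1 + (q - 1) * μ) ^ 2 + (1 - ν) * (1 + (q - 1) * μ ^ 2))) ^ n := by
  have hw : ∀ (s : ℝ) (x y : Word q n),
      s ^ hammingDist x y = ∏ i, if x i ≠ y i then s else 1 := by
    intro s x y
    rw [hammingDist, Finset.prod_ite]
    simp
  let e : (Fin n → Fin q × Fin q × Fin q) ≃ Word q n × Word q n × Word q n :=
    { toFun := fun t => (fun i => (t i).1, fun i => (t i).2.1, fun i => (t i).2.2)
      invFun := fun x i => (x.1 i, x.2.1 i, x.2.2 i)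
      left_inv := fun _ => rfl
      right_inv := fun _ => rfl }
  have htot : ∑ x : Word q n × Word q n × Word q n, μ ^ hammingDist x.1 x.2.1 *
      ν ^ hammingDist x.2.1 x.2.2 * μ ^ hammingDist x.1 x.2.2 =
      (q * (ν * (1 + (q - 1) * μ) ^ 2 + (1 - ν) * (1 + (q - 1) * μ ^ 2))) ^ n := by
    rw [← sum_triangle_weight q, Finset.sum_pow', Fintype.piFinset_univ, ← e.sum_comp]
    refine Finset.sum_congr rfl fun t _ => ?_
    simp_rw [hw, ← Finset.prod_mul_distrib]
    rfl
  -- Markov: as `μ, ν ≤ 1`, every close triple has weight at least `μ ^ (2 * d) * ν ^ d`.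
  rw [← htot, mul_comm, ← nsmul_eq_mul]
  refine (Finset.card_nsmul_le_sum _ (fun x : Word q n × Word q n × Word q n =>
    μ ^ hammingDist x.1 x.2.1 * ν ^ hammingDist x.2.1 x.2.2 * μ ^ hammingDist x.1 x.2.2) _
    ?_).trans (Finset.sum_le_sum_of_subset_of_nonneg (Finset.subset_univ _)
      (fun x _ _ => by positivity))
  intro x hx
  obtain ⟨-, h1, h2, h3⟩ := mem_filter.1 hx
  calc μ ^ (2 * d) * ν ^ d = μ ^ d * ν ^ d * μ ^ d := by ring
    _ ≤ _ := by
      gcongr ?_ * ?_ * ?_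
      · exact pow_le_pow_of_le_one hμ0.le hμ1 h1
      · exact pow_le_pow_of_le_one hν0.le hν1 h2
      · exact pow_le_pow_of_le_one hμ0.le hμ1 h3

/-- The largest term in the binomial expansion of `(1 + p / (1 - p)) ^ n` is, up to a constant
factor, the one of index `⌊p * n⌋`. -/
theorem binomial_le_floor_term {p : ℝ} (hp0 : 0 < p) (hp1 : p < 1) {n : ℕ} (hn : 1 ≤ n) :
    (1 / (1 - p)) ^ n ≤ (1 + 1 / (1 - p)) * (n + 1) *
      ((p / (1 - p)) ^ ⌊p * n⌋₊ * n.choose ⌊p * n⌋₊) := by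
  set d := ⌊p * (n : ℝ)⌋₊ with hd
  set x := p / (1 - p) with hx
  have h1p : 0 < 1 - p := by linarith
  have hx0 : 0 < x := by positivity
  have hn' : (1 : ℝ) ≤ n := by exact_mod_cast hn
  have hdle : (d : ℝ) ≤ p * n := Nat.floor_le (by positivity)
  have hdlt : p * n < d + 1 := Nat.lt_floor_add_one _
  have hdn : d < n := by
    have : (d : ℝ) < n := by nlinarith
    exact_mod_cast this
  set a : ℕ → ℝ := fun i => x ^ i * n.choose i with ha
  have ha0 : ∀ i, 0 ≤ a i := fun i => by positivity
  -- Ratio of consecutive terms: they increase up to `d` and decrease from `d + 1`, while the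
  -- undecided step `d → d + 1` gains at most `1 + 1 / (1 - p)`.
  have hrec : ∀ i, i ≤ n → a (i + 1) * (i + 1) * (1 - p) = a i * ((n - i) * p) := by
    intro i hi
    have h := Nat.choose_succ_right_eq n i
    have h' : (n.choose (i + 1) : ℝ) * (i + 1) = n.choose i * (n - i) := by
      rw [← Nat.cast_sub hi]; exact_mod_cast h
    have hxp : x * (1 - p) = p := by rw [hx]; field_simp
    calc a (i + 1) * (i + 1) * (1 - p)
        = x ^ i * (x * (1 - p)) * (n.choose (i + 1) * (i + 1)) := by simp only [ha]; ring
      _ = a i * ((n - i) * p) := by rw [hxp, h']; simp only [ha]; ring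
  have hup : ∀ i, i < d → a i ≤ a (i + 1) := by
    intro i hi
    have h := hrec i (by omega)
    have hi' : (i : ℝ) + 1 ≤ d := by exact_mod_cast hi
    have hc : ((i : ℝ) + 1) * (1 - p) ≤ (n - i) * p := by nlinarith
    have hpos : 0 < ((i : ℝ) + 1) * (1 - p) := by positivity
    refine le_of_mul_le_mul_right ?_ hpos
    calc a i * (((i : ℝ) + 1) * (1 - p)) ≤ a i * ((n - i) * p) :=
          mul_le_mul_of_nonneg_left hc (ha0 i)
      _ = a (i + 1) * (((i : ℝ) + 1) * (1 - p)) := by rw [← h]; ring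
  have hdown : ∀ i, d + 1 ≤ i → i < n → a (i + 1) ≤ a i := by
    intro i hi hin
    have h := hrec i hin.le
    have hi' : (d : ℝ) + 1 ≤ i := by exact_mod_cast hi
    have hc : ((n : ℝ) - i) * p ≤ (i + 1) * (1 - p) := by nlinarith
    have hpos : 0 < ((i : ℝ) + 1) * (1 - p) := by positivity
    refine le_of_mul_le_mul_right ?_ hpos
    calc a (i + 1) * (((i : ℝ) + 1) * (1 - p)) = a i * ((n - i) * p) := by rw [← h]; ring
      _ ≤ a i * (((i : ℝ) + 1) * (1 - p)) := mul_le_mul_of_nonneg_left hc (ha0 i)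
  have hmid : a (d + 1) ≤ (1 + 1 / (1 - p)) * a d := by
    have h := hrec d hdn.le
    have hc : ((n : ℝ) - d) * p ≤ (1 + 1 / (1 - p)) * ((d + 1) * (1 - p)) := by
      have : (1 + 1 / (1 - p)) * (((d : ℝ) + 1) * (1 - p)) = (d + 1) * (1 - p) + (d + 1) := by
        field_simp
      rw [this]
      nlinarith
    have hpos : 0 < ((d : ℝ) + 1) * (1 - p) := by positivity
    refine le_of_mul_le_mul_right ?_ hpos
    calc a (d + 1) * (((d : ℝ) + 1) * (1 - p)) = a d * ((n - d) * p) := by rw [← h]; ring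
      _ ≤ a d * ((1 + 1 / (1 - p)) * ((d + 1) * (1 - p))) :=
          mul_le_mul_of_nonneg_left hc (ha0 d)
      _ = _ := by ring
  have hC : 1 ≤ 1 + 1 / (1 - p) := by
    have : 0 < 1 / (1 - p) := by positivity
    linarith
  have hall : ∀ i, i ≤ n → a i ≤ (1 + 1 / (1 - p)) * a d := by
    intro i hi
    rcases le_or_gt i d with h | h
    · have : a i ≤ a d := by
        refine Nat.decreasingInduction' (P := fun j => a j ≤ a d) ?_ h le_rfl
        intro j hj _ ih
        exact (hup j hj).trans ih
      nlinarith [ha0 d]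
    · refine le_trans ?_ hmid
      induction i, h using Nat.le_induction with
      | base => exact le_rfl
      | succ j hj ih => exact (hdown j hj (by omega)).trans (ih (by omega))
  have hexp : (1 / (1 - p)) ^ n = ∑ i ∈ range (n + 1), a i := by
    have : 1 / (1 - p) = x + 1 := by rw [hx]; field_simp; ring
    rw [this, add_pow]
    simp [ha]
  rw [hexp]
  refine (Finset.sum_le_card_nsmul _ _ _
    (fun i hi => hall i (by simpa [Nat.lt_succ_iff] using hi))).trans (le_of_eq ?_)
  rw [card_range, nsmul_eq_mul]
  push_cast
  ring

end QaryCode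

/-! ### Exponential sparsity and the choice of parameters. -/

namespace QaryCode
open Finset

/-- The number of triples of words of length `n` at pairwise distance at most `d`. -/
def closeTriples (q n d : ℕ) : ℕ :=
  (univ.filter fun x : Word q n × Word q n × Word q n =>
    hammingDist x.1 x.2.1 ≤ d ∧ hammingDist x.2.1 x.2.2 ≤ d ∧ hammingDist x.1 x.2.2 ≤ d).card

/-- At `ε = 0` both sides equal `1`, with slopes `-P` and `-p`, so a small `ε` works. The witness
makes `P * (1 - ε)` the midpoint of `p` and `P`. -/
theorem one_sub_mul_lt_rpow {p P : ℝ} (hp : 0 < p) (hP : p < P) :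
    ∃ ε, 0 < ε ∧ ε < 1 ∧ 1 - ε * P < (1 - ε) ^ p := by
  have hP0 : 0 < P := hp.trans hP
  have h1 : p / P < 1 := (div_lt_one hP0).2 hP
  have h2 : 0 < p / P := by positivity
  refine ⟨(1 - p / P) / 2, by linarith, by linarith, ?_⟩
  set ε := (1 - p / P) / 2 with hε
  have he0 : 0 < ε := by linarith
  have he1 : 0 < 1 - ε := by linarith
  have hPe : p < P * (1 - ε) := by
    have : P * (1 - ε) = (P + p) / 2 := by rw [hε]; field_simp; ring
    linarith
  have hlog : 1 - (1 - ε)⁻¹ ≤ Real.log (1 - ε) := Real.one_sub_inv_le_log_of_pos he1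
  have hkey : -(ε * P) < Real.log (1 - ε) * p := by
    have h3 : 1 - (1 - ε)⁻¹ = -(ε / (1 - ε)) := by field_simp; ring
    have h4 : ε / (1 - ε) * p < ε * P := by
      rw [div_mul_eq_mul_div, div_lt_iff₀ he1]
      nlinarith
    nlinarith
  rw [Real.rpow_def_of_pos he1]
  calc 1 - ε * P ≤ Real.exp (-(ε * P)) := by linarith [Real.add_one_le_exp (-(ε * P))]
    _ < _ := Real.exp_lt_exp.2 hkey

/-- Balls of radius `⌊p * n⌋` are exponentially large, and the graph joining words at distance at
most `⌊p * n⌋` is exponentially sparser inside neighbourhoods than the degrees allow. -/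
theorem exists_sparsity_rate (q : ℕ) (hq : 2 ≤ q) {p : ℝ} (hp0 : 0 < p)
    (hp1 : p < ((q : ℝ) - 1) / q) :
    ∃ β C : ℝ, 0 < β ∧ β < 1 ∧ 0 < C ∧ ∀ n : ℕ, 1 ≤ n →
      (closeTriples q n ⌊p * n⌋₊ : ℝ) ≤
        q ^ n * (vol q n ⌊p * n⌋₊ : ℝ) ^ 2 * (C * (n + 1)) ^ 2 * β ^ n ∧
      1 ≤ (vol q n ⌊p * n⌋₊ : ℝ) * (C * (n + 1)) * β ^ n := by
  have hq' : (2 : ℝ) ≤ q := by exact_mod_cast hq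
  have hq1 : 0 < (q : ℝ) - 1 := by linarith
  have hpq : p * q < q - 1 := by rwa [lt_div_iff₀ (by linarith)] at hp1
  have hp1' : p < 1 := by nlinarith
  have h1p : 0 < 1 - p := by linarith
  -- The optimal tilt for a ball of radius `p * n`: each letter changes with probability `p`. Then
  -- `P` is the probability that two independent such changes of one letter disagree.
  set μ := p / ((1 - p) * (q - 1)) with hμ
  set W := 1 / (1 - p) with hW
  set P := 1 - (1 - p) ^ 2 - p ^ 2 / (q - 1) with hP
  have hμ0 : 0 < μ := by positivity
  have hμ1 : μ ≤ 1 := by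
    rw [hμ, div_le_one (by positivity)]
    nlinarith
  have hW1 : 1 < W := by rw [hW, lt_div_iff₀ h1p]; linarith
  have hWμ : 1 + (q - 1) * μ = W := by rw [hμ, hW]; field_simp; ring
  have hPp : p < P := by
    have : p ^ 2 / (q - 1) < p * (1 - p) := by
      rw [div_lt_iff₀ hq1]; nlinarith
    rw [hP]; nlinarith
  obtain ⟨ε, he0, he1, hε⟩ := one_sub_mul_lt_rpow hp0 hPp
  set ν := 1 - ε with hν
  have hν0 : 0 < ν := by linarith
  have hν1 : ν ≤ 1 := by linarith
  set S := ν * (1 + (q - 1) * μ) ^ 2 + (1 - ν) * (1 + (q - 1) * μ ^ 2) with hS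
  have hS0 : 0 < S := by
    have : 0 ≤ 1 - ν := by linarith
    positivity
  have hSW : S = W ^ 2 * (1 - ε * P) := by
    rw [hS, hWμ, hν, hμ, hW, hP]
    field_simp
    ring
  -- At `ν = 1` the moment bound only gives `q ^ n * B ^ 2` up to polynomial factors; lowering `ν`
  -- gains `1 - ε * P` per coordinate and pays only `ν ^ p`.
  set β₀ := (1 - ε * P) / ν ^ p with hβ₀
  have hνp : 0 < ν ^ p := Real.rpow_pos_of_pos hν0 p
  have hPe : 0 < 1 - ε * P := by
    rw [hSW] at hS0
    exact pos_of_mul_pos_right hS0 (by positivity)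
  have hβ₀0 : 0 < β₀ := by positivity
  have hβ₀1 : β₀ < 1 := (div_lt_one hνp).2 hε
  set C := 1 + 1 / (1 - p) with hC
  have hC0 : 0 < C := by positivity
  refine ⟨max β₀ (1 / W), C, lt_max_of_lt_left hβ₀0, max_lt hβ₀1 ((div_lt_one (by linarith)).2 hW1),
    hC0, fun n hn => ?_⟩
  set d := ⌊p * (n : ℝ)⌋₊ with hd
  set B : ℝ := (vol q n d : ℝ) with hB
  have hB0 : 0 ≤ B := Nat.cast_nonneg _
  have hball : W ^ n ≤ C * (n + 1) * (μ ^ d * B) := by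
    refine (binomial_le_floor_term hp0 hp1' hn).trans
      (mul_le_mul_of_nonneg_left ?_ (by positivity))
    have hx : p / (1 - p) = μ * (q - 1) := by rw [hμ]; field_simp
    rw [← hd, hx, mul_pow, mul_assoc]
    gcongr
    have : n.choose d * (q - 1) ^ d ≤ vol q n d :=
      Finset.single_le_sum (f := fun i => n.choose i * (q - 1) ^ i) (fun _ _ => Nat.zero_le _)
        (by simp)
    rw [hB, mul_comm]
    have h2 : (((n.choose d * (q - 1) ^ d : ℕ)) : ℝ) ≤ vol q n d := by exact_mod_cast this
    rw [Nat.cast_mul, Nat.cast_pow, Nat.cast_sub (by omega), Nat.cast_one] at h2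
    exact h2
  constructor
  · have htri : μ ^ (2 * d) * ν ^ d * (closeTriples q n d : ℝ) ≤ (q * S) ^ n :=
      card_close_triples_le q n d hμ0 hμ1 hν0 hν1
    have hSn : S ^ n ≤ W ^ (2 * n) * β₀ ^ n * ν ^ d := by
      have h1 : S = W ^ 2 * β₀ * ν ^ p := by
        rw [hSW, hβ₀, mul_assoc, div_mul_cancel₀ _ hνp.ne']
      rw [h1, mul_pow, mul_pow, ← pow_mul]
      gcongr
      rw [← Real.rpow_natCast (ν ^ p), ← Real.rpow_mul hν0.le, ← Real.rpow_natCast ν]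
      exact Real.rpow_le_rpow_of_exponent_ge hν0 hν1 (Nat.floor_le (by positivity))
    have hWn : W ^ (2 * n) ≤ (C * (n + 1)) ^ 2 * (μ ^ (2 * d) * B ^ 2) := by
      calc W ^ (2 * n) = (W ^ n) ^ 2 := by ring
        _ ≤ (C * (n + 1) * (μ ^ d * B)) ^ 2 := by gcongr
        _ = _ := by ring
    have hmain : (closeTriples q n d : ℝ) ≤ q ^ n * B ^ 2 * (C * (n + 1)) ^ 2 * β₀ ^ n := by
      refine le_of_mul_le_mul_left ?_ (show 0 < μ ^ (2 * d) * ν ^ d by positivity)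
      calc μ ^ (2 * d) * ν ^ d * (closeTriples q n d : ℝ) ≤ q ^ n * S ^ n := by
            rw [← mul_pow]; exact htri
        _ ≤ q ^ n * (W ^ (2 * n) * β₀ ^ n * ν ^ d) := by gcongr
        _ ≤ q ^ n * ((C * (n + 1)) ^ 2 * (μ ^ (2 * d) * B ^ 2) * β₀ ^ n * ν ^ d) := by gcongr
        _ = _ := by ring
    refine hmain.trans ?_
    gcongr
    exact le_max_left _ _
  · have hWn : 0 < W ^ n := by positivity
    have h1 : W ^ n ≤ C * (n + 1) * B := by
      refine hball.trans ?_
      gcongr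
      exact mul_le_of_le_one_left hB0 (pow_le_one₀ hμ0.le hμ1)
    calc (1 : ℝ) = W ^ n * (1 / W) ^ n := by rw [← mul_pow, mul_one_div_cancel (by positivity), one_pow]
      _ ≤ C * (n + 1) * B * (max β₀ (1 / W)) ^ n := by
        gcongr
        exact le_max_right _ _
      _ = _ := by ring

/-- For all large `n` there are exponentially many codes of a suitable common size. -/
theorem exists_many_codes_of_size (q : ℕ) (hq : 2 ≤ q) {p : ℝ} (hp0 : 0 < p)
    (hp1 : p < ((q : ℝ) - 1) / q) :
    ∃ a γ : ℝ, ∃ n₀ : ℕ, 0 < a ∧ 0 < γ ∧ ∀ n : ℕ, n₀ ≤ n → ∃ k : ℕ,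
      a * n * ((q : ℝ) ^ n / (vol q n ⌊p * n⌋₊ : ℝ)) ≤ k ∧
      Real.exp (γ * n * k) ≤
        (((codes q n (⌊p * n⌋₊ + 1)).filter fun C => C.card = k).card : ℝ) := by
  obtain ⟨β, C, hβ0, hβ1, hC, hβ⟩ := exists_sparsity_rate q hq hp0 hp1
  -- Splits `β ^ n` into four factors `r ^ n`, to be spent separately on polynomial factors and on
  -- powers of `D`.
  obtain ⟨r, hr0, hr1, rfl⟩ : ∃ r : ℝ, 0 < r ∧ r < 1 ∧ r ^ 4 = β := by
    refine ⟨√(√β), by positivity, ?_, ?_⟩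
    · rw [Real.sqrt_lt' one_pos, Real.sqrt_lt' (by norm_num)]; simpa using hβ1
    · rw [show (4 : ℕ) = 2 * 2 by rfl, pow_mul, Real.sq_sqrt (by positivity), Real.sq_sqrt hβ0.le]
  -- `1024 = 32 ^ 2`, so that `D = 32 ^ (n / K)` satisfies `D ^ 2 * r ^ n ≤ 1`.
  obtain ⟨K, hK⟩ := exists_pow_lt_of_lt_one (show (0 : ℝ) < 1 / 1024 by norm_num) hr1
  have hK0 : 0 < K := by
    rcases Nat.eq_zero_or_pos K with rfl | h
    · norm_num at hK
    · exact h
  have hlim : Filter.Tendsto (fun n : ℕ => C * ((n : ℝ) + 1) * r ^ n) Filter.atTop (nhds 0) := by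
    have h1 := tendsto_self_mul_const_pow_of_lt_one hr0.le hr1
    have h2 := tendsto_pow_atTop_nhds_zero_of_lt_one hr0.le hr1
    have := (h1.add h2).const_mul C
    simp only [add_zero, mul_zero] at this
    refine this.congr fun n => ?_
    ring
  obtain ⟨n₁, hn₁⟩ := Filter.eventually_atTop.1 (hlim.eventually_le_const (show (0 : ℝ) < 1 by simp))
  refine ⟨1 / (256 * K), -Real.log r, max n₁ K, by positivity, by
    have := Real.log_neg hr0 hr1
    linarith, fun n hn => ?_⟩
  have hnK : K ≤ n := (le_max_right _ _).trans hn
  have hpoly := hn₁ n ((le_max_left _ _).trans hn)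
  obtain ⟨hT, hB⟩ := hβ n (by omega)
  set d := ⌊p * (n : ℝ)⌋₊ with hd
  have hq1 : (1 : ℝ) ≤ q := by exact_mod_cast (show 1 ≤ q by omega)
  have hdn : d ≤ n := by
    have h1 : p ≤ 1 := hp1.le.trans ((div_le_one (by linarith)).2 (by linarith))
    exact Nat.floor_le_of_le (mul_le_of_le_one_left (Nat.cast_nonneg n) h1)
  set B := vol q n d with hBdef
  have hB1 : 1 ≤ B := one_le_vol q n d
  have hBN : B ≤ q ^ n := vol_le q n d (by omega) hdn
  set L := n / K with hLdef
  have hL1 : 1 ≤ L := (Nat.one_le_div_iff hK0).2 hnK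
  have hKL : K * L ≤ n := Nat.mul_div_le n K
  have hnL : n ≤ 2 * K * L := by
    have := Nat.lt_mul_div_succ n hK0
    nlinarith
  set D := 32 ^ L with hD
  have hD32 : 32 ≤ D := by
    calc 32 = 32 ^ 1 := by norm_num
      _ ≤ 32 ^ L := Nat.pow_le_pow_right (by norm_num) hL1
  set N := q ^ n with hN
  have hN1 : 1 ≤ N := Nat.one_le_pow _ _ (by omega)
  -- The largest sample allowed by the condition on pairs; it is nonempty because `B ≤ N` and `D ≥
  -- 32`.
  set m := N * D / (16 * B) with hm
  have hmle : m * (16 * B) ≤ N * D := Nat.div_mul_le_self _ _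
  have hm1 : 1 ≤ m := (Nat.one_le_div_iff (by positivity)).2 (by nlinarith)
  have hmge : N * D ≤ 2 * (m * (16 * B)) := by
    have := Nat.lt_mul_div_succ (N * D) (show 0 < 16 * B by positivity)
    rw [← hm] at this
    nlinarith
  -- The ceiling of `L * m / (4 * D)`, so `k ≥ 1`.
  set k := (L * m - 1) / (4 * D) + 1 with hk
  have hLm : 1 ≤ L * m := Nat.mul_pos hL1 hm1
  have hk1 : 4 * D * (k - 1) < L * m := by
    have := Nat.mul_div_le (L * m - 1) (4 * D)
    rw [hk, Nat.add_sub_cancel]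
    omega
  have hk2 : L * m ≤ 4 * D * k := by
    have := Nat.lt_mul_div_succ (L * m - 1) (show 0 < 4 * D by positivity)
    rw [hk]
    omega
  have hrn0 : 0 < r ^ n := by positivity
  have hrn1 : r ^ n ≤ 1 := pow_le_one₀ hr0.le hr1.le
  have hDr : (D : ℝ) ^ 2 * r ^ n ≤ 1 := by
    have h1 : r ^ n ≤ (1 / 1024) ^ L := by
      calc r ^ n ≤ r ^ (K * L) := pow_le_pow_of_le_one hr0.le hr1.le hKL
        _ = (r ^ K) ^ L := pow_mul _ _ _
        _ ≤ _ := by gcongr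
    calc (D : ℝ) ^ 2 * r ^ n ≤ (D : ℝ) ^ 2 * (1 / 1024) ^ L := by gcongr
      _ = 1 := by
        rw [hD, Nat.cast_pow, ← pow_mul, mul_comm L 2, pow_mul, ← mul_pow]
        norm_num
  have hNR : ((q : ℝ) ^ n) = N := by simp [hN]
  have hBR : (1 : ℝ) ≤ B := by exact_mod_cast hB1
  have hmR : (m : ℝ) * (16 * B) ≤ N * D := by exact_mod_cast hmle
  have hTN : 16 * m ^ 2 * closeTriples q n d ≤ N ^ 3 := by
    have hx : (C * ((n : ℝ) + 1) * r ^ n) ^ 2 ≤ 1 := pow_le_one₀ (by positivity) hpoly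
    have h1 : (16 * m ^ 2 * closeTriples q n d : ℝ) ≤ N ^ 3 := by
      rw [hNR] at hT
      calc (16 * m ^ 2 * closeTriples q n d : ℝ)
          ≤ 16 * m ^ 2 * (N * (B : ℝ) ^ 2 * (C * (n + 1)) ^ 2 * (r ^ 4) ^ n) := by gcongr
        _ = N / 16 * (m * (16 * B)) ^ 2 * ((C * (n + 1)) ^ 2 * (r ^ 4) ^ n) := by ring
        _ ≤ N / 16 * (N * D) ^ 2 * ((C * (n + 1)) ^ 2 * (r ^ 4) ^ n) := by gcongr
        _ = N ^ 3 / 16 * (((D : ℝ) ^ 2 * r ^ n) * (C * (n + 1) * r ^ n) ^ 2 * r ^ n) := by ring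
        _ ≤ N ^ 3 / 16 * (1 * 1 * 1) := by gcongr
        _ ≤ N ^ 3 := by
          have : (0 : ℝ) ≤ (N : ℝ) ^ 3 := by positivity
          linarith
    exact_mod_cast h1
  have hcard : Fintype.card (Word q n) = N := by simp [hN]
  have hcount := card_pow_le_card_indep (V := Word q n) (fun x y => hammingDist x y ≤ d)
    (fun x => by simp) (fun x y h => by rwa [hammingDist_comm]) (m := m) (D := D) (L := L) (k := k)
    (by omega) (by omega)
    (by
      rw [card_close_pairs, hcard]
      calc 16 * m * (N * B) = N * (m * (16 * B)) := by ring
        _ ≤ N * (N * D) := by gcongr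
        _ = N ^ 2 * D := by ring)
    (by rw [hcard]; exact hTN) le_rfl hk1
  have hset : (univ.filter fun C : Finset (Word q n) =>
      C.card = k ∧ ∀ x ∈ C, ∀ y ∈ C, x ≠ y → ¬ hammingDist x y ≤ d) =
      (codes q n (d + 1)).filter fun C => C.card = k := by
    ext X
    simp only [codes, HasMinDist, mem_filter, mem_univ, true_and, not_le, Nat.succ_le_iff]
    exact and_comm
  rw [hset, hcard] at hcount
  refine ⟨k, ?_, ?_⟩
  · rw [hNR]
    have h1 : (N : ℝ) * D ≤ 2 * (m * (16 * B)) := by exact_mod_cast hmge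
    have h2 : (L : ℝ) * m ≤ 4 * D * k := by exact_mod_cast hk2
    have h3 : (n : ℝ) ≤ 2 * K * L := by exact_mod_cast hnL
    have hD0 : (0 : ℝ) < D := by positivity
    have hK0' : (0 : ℝ) < K := by exact_mod_cast hK0
    have h4 : (N : ℝ) * L ≤ 128 * B * k := by
      refine le_of_mul_le_mul_left ?_ hD0
      calc (D : ℝ) * (N * L) = N * D * L := by ring
        _ ≤ 2 * (m * (16 * B)) * L := by gcongr
        _ = 32 * B * (L * m) := by ring
        _ ≤ 32 * B * (4 * D * k) := by gcongr
        _ = D * (128 * B * k) := by ring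
    rw [one_div, ← div_eq_inv_mul, div_mul_div_comm, div_le_iff₀ (by positivity)]
    calc (n : ℝ) * N ≤ 2 * K * L * N := by gcongr
      _ = 2 * K * (N * L) := by ring
      _ ≤ 2 * K * (128 * B * k) := by gcongr
      _ = k * (256 * K * B) := by ring
  · set I := (((codes q n (d + 1)).filter fun C => C.card = k).card : ℝ) with hI
    have hexp : Real.exp (-Real.log r * n * k) = ((1 / r ^ n) ^ k : ℝ) := by
      rw [show -Real.log r * n * k = (k : ℕ) * ((n : ℕ) * -Real.log r) by ring, Real.exp_nat_mul,
        Real.exp_nat_mul, Real.exp_neg, Real.exp_log hr0]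
      simp
    have hDB : (D : ℝ) ≤ B * r ^ n := by
      have hD1 : (1 : ℝ) ≤ D := by exact_mod_cast (by omega : 1 ≤ D)
      have hDr' : (D : ℝ) * r ^ n ≤ 1 := by
        refine le_trans ?_ hDr
        gcongr
        nlinarith
      calc (D : ℝ) = D * 1 := by ring
        _ ≤ D * (B * (C * (n + 1)) * (r ^ 4) ^ n) := by gcongr
        _ = B * r ^ n * ((D * r ^ n) * (C * (n + 1) * r ^ n) * r ^ n) := by ring
        _ ≤ B * r ^ n * (1 * 1 * 1) := by gcongr
        _ = B * r ^ n := by ring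
    -- The spare factor `2`, raised to the power `k ≥ 1`, absorbs the `2` in `hcount`.
    have hmN : 2 * (m : ℝ) ≤ N * r ^ n := by
      refine le_of_mul_le_mul_right ?_ (show (0 : ℝ) < B by linarith)
      have h0 : (0 : ℝ) ≤ m * B := by positivity
      calc 2 * (m : ℝ) * B ≤ m * (16 * B) := by linarith
        _ ≤ N * D := hmR
        _ ≤ N * (B * r ^ n) := by gcongr
        _ = N * r ^ n * B := by ring
    have hcR : (N : ℝ) ^ k ≤ 2 * (m ^ k * I) := by rw [hI]; exact_mod_cast hcount
    rw [hexp, one_div_pow, div_le_iff₀ (by positivity)]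
    have hm0 : (0 : ℝ) < m := by exact_mod_cast hm1
    refine le_of_mul_le_mul_left ?_ (show (0 : ℝ) < 2 * m ^ k by positivity)
    calc 2 * (m : ℝ) ^ k * 1 ≤ 2 ^ k * (m : ℝ) ^ k := by
          rw [mul_one]
          gcongr
          calc (2 : ℝ) = 2 ^ 1 := by norm_num
            _ ≤ 2 ^ k := pow_le_pow_right₀ (by norm_num) (Nat.le_add_left 1 _)
      _ = (2 * m) ^ k := (mul_pow _ _ _).symm
      _ ≤ (N * r ^ n) ^ k := by gcongr
      _ = N ^ k * (r ^ n) ^ k := mul_pow _ _ _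
      _ ≤ 2 * (m ^ k * I) * (r ^ n) ^ k := by gcongr
      _ = 2 * m ^ k * (I * (r ^ n) ^ k) := by ring

theorem empty_mem_codes (q n d : ℕ) : ∅ ∈ codes q n d := by
  refine mem_filter.2 ⟨mem_univ _, ?_⟩
  simp [HasMinDist]

theorem singleton_mem_codes {q n : ℕ} (d : ℕ) (x : Word q n) : {x} ∈ codes q n d := by
  refine mem_filter.2 ⟨mem_univ _, ?_⟩
  simp [HasMinDist]

end QaryCode

/-! ### Combination with the finitely many small lengths. -/

open QaryCode in
theorem theorem2p5 (q : ℕ) (hq : 2 ≤ q) (p : ℝ) (hp0 : 0 < p)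
    (hp1 : p < ((q : ℝ) - 1) / (q : ℝ)) :
    (∃ c : ℝ, 0 < c ∧ ∀ n : ℕ, 1 ≤ n →
      Real.exp (c * (n : ℝ) ^ 2 * ((q : ℝ) ^ n / (QaryCode.vol q n ⌊p * (n : ℝ)⌋₊ : ℝ))) ≤
        ((QaryCode.codes q n (⌊p * (n : ℝ)⌋₊ + 1)).card : ℝ)) ∧
    (∃ c : ℝ, 0 < c ∧ ∀ n : ℕ, 1 ≤ n →
      c * (n : ℝ) * ((q : ℝ) ^ n / (QaryCode.vol q n ⌊p * (n : ℝ)⌋₊ : ℝ)) ≤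
        (QaryCode.maxSize q n (⌊p * (n : ℝ)⌋₊ + 1) : ℝ)) := by

  obtain ⟨a, γ, n₀, ha, hγ, hlarge⟩ := exists_many_codes_of_size q hq hp0 hp1
  have hq1 : (1 : ℝ) ≤ q := by exact_mod_cast (show 1 ≤ q by omega)
  have hratio : ∀ n : ℕ, (q : ℝ) ^ n / (vol q n ⌊p * (n : ℝ)⌋₊ : ℝ) ≤ q ^ n := fun n =>
    div_le_self (by positivity) (by exact_mod_cast one_le_vol q n _)
  have hratio0 : ∀ n : ℕ, 0 ≤ (q : ℝ) ^ n / (vol q n ⌊p * (n : ℝ)⌋₊ : ℝ) := fun n => by positivity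
  -- For `n < n₀` the constants built from `M` push the bounds below `2` and `1`, which the empty
  -- code and a singleton already attain.
  set M : ℝ := ((n₀ : ℝ) + 1) * q ^ n₀ with hM
  have hM0 : 0 < M := by positivity
  have hsmall : ∀ n : ℕ, n < n₀ → n * ((q : ℝ) ^ n / (vol q n ⌊p * (n : ℝ)⌋₊ : ℝ)) ≤ M := by
    intro n hn
    have hn' : (n : ℝ) ≤ n₀ + 1 := by exact_mod_cast (by omega : n ≤ n₀ + 1)
    have := (hratio n).trans (pow_le_pow_right₀ hq1 hn.le)
    have := hratio0 n
    rw [hM]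
    gcongr
  have hword : ∀ n, Nonempty (Word q n) := fun n => ⟨fun _ => ⟨0, by omega⟩⟩
  constructor
  · have hlog : 0 < Real.log 2 := Real.log_pos (by norm_num)
    refine ⟨min (γ * a) (Real.log 2 / (((n₀ : ℝ) + 1) * M)), by positivity, fun n hn => ?_⟩
    have hX := hratio0 n
    rcases le_or_gt n₀ n with h | h
    · obtain ⟨k, hk, hcard⟩ := hlarge n h
      calc _ ≤ Real.exp (γ * n * k) := by
            rw [Real.exp_le_exp]
            calc _ ≤ γ * a * (n : ℝ) ^ 2 * ((q : ℝ) ^ n / (vol q n ⌊p * (n : ℝ)⌋₊ : ℝ)) := by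
                  gcongr
                  exact min_le_left _ _
              _ = γ * n * (a * n * ((q : ℝ) ^ n / (vol q n ⌊p * (n : ℝ)⌋₊ : ℝ))) := by ring
              _ ≤ γ * n * k := by gcongr
        _ ≤ _ := hcard
        _ ≤ _ := by exact_mod_cast Finset.card_filter_le _ _
    · obtain ⟨x⟩ := hword n
      have h2 : 2 ≤ (codes q n (⌊p * (n : ℝ)⌋₊ + 1)).card :=
        Finset.one_lt_card.2 ⟨∅, empty_mem_codes _ _ _, {x}, singleton_mem_codes _ _,
          (Finset.singleton_ne_empty x).symm⟩
      calc _ ≤ Real.exp (Real.log 2) := by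
            rw [Real.exp_le_exp]
            have hn' : (n : ℝ) ≤ n₀ + 1 := by exact_mod_cast (by omega : n ≤ n₀ + 1)
            calc _ ≤ Real.log 2 / (((n₀ : ℝ) + 1) * M) * (n : ℝ) ^ 2 *
                    ((q : ℝ) ^ n / (vol q n ⌊p * (n : ℝ)⌋₊ : ℝ)) := by
                  gcongr
                  exact min_le_right _ _
              _ = Real.log 2 / (((n₀ : ℝ) + 1) * M) *
                    (n * (n * ((q : ℝ) ^ n / (vol q n ⌊p * (n : ℝ)⌋₊ : ℝ)))) := by ring
              _ ≤ Real.log 2 / (((n₀ : ℝ) + 1) * M) * ((n₀ + 1) * M) := by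
                  have := hsmall n h
                  gcongr
              _ = Real.log 2 := div_mul_cancel₀ _ (by positivity)
        _ = 2 := Real.exp_log (by norm_num)
        _ ≤ _ := by exact_mod_cast h2
  · refine ⟨min a (1 / M), by positivity, fun n hn => ?_⟩
    have hX := hratio0 n
    rcases le_or_gt n₀ n with h | h
    · obtain ⟨k, hk, hcard⟩ := hlarge n h
      have hpos : 0 < ((codes q n (⌊p * (n : ℝ)⌋₊ + 1)).filter fun C => C.card = k).card := by
        exact_mod_cast (Real.exp_pos _).trans_le hcard
      obtain ⟨C, hC⟩ := Finset.card_pos.1 hpos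
      obtain ⟨hC', rfl⟩ := Finset.mem_filter.1 hC
      calc _ ≤ a * n * ((q : ℝ) ^ n / (vol q n ⌊p * (n : ℝ)⌋₊ : ℝ)) := by
            gcongr
            exact min_le_left _ _
        _ ≤ C.card := hk
        _ ≤ _ := by exact_mod_cast Finset.le_sup (f := Finset.card) hC'
    · obtain ⟨x⟩ := hword n
      have h1 : 1 ≤ maxSize q n (⌊p * (n : ℝ)⌋₊ + 1) :=
        Finset.le_sup (f := Finset.card) (singleton_mem_codes (⌊p * (n : ℝ)⌋₊ + 1) x)
      calc _ ≤ 1 / M * n * ((q : ℝ) ^ n / (vol q n ⌊p * (n : ℝ)⌋₊ : ℝ)) := by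
            gcongr
            exact min_le_right _ _
        _ = 1 / M * (n * ((q : ℝ) ^ n / (vol q n ⌊p * (n : ℝ)⌋₊ : ℝ))) := by ring
        _ ≤ 1 / M * M := by
            gcongr
            exact hsmall n h
        _ = 1 := one_div_mul_cancel hM0.ne'
        _ ≤ _ := by exact_mod_cast h1
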